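/- Let $p>2$ be a real number and $\alpha=p-1$. For a real sequence $a=(a_n)_{n\in\mathbb Z}$ let $$(\Delta_p a)_n=(a_{n+1}-a_n)\,|a_{n+1}-a_n|^{p-2}-(a_n-a_{n-1})\,|a_n-a_{n-1}|^{p-2}$$ be the discrete $p$-Laplacian, and consider, for $s\in\{1,-1\}$, the stationary discrete $p$-Schrödinger (DpS) equation $$-s\,a_n=(\Delta_p a)_n,\qquad n\in\mathbb Z. \tag{E_s}$$ (i) For $s=1$, equation $(E_1)$ has two solutions $a^1,a^2$ such that, for $i=1,2$, $\lim_{n\to\pm\infty}a^i_n=0$, $(-1)^n a^i_n>0$ for all $n\in\mathbb Z$, and $|a^i_n|>|a^i_{n-1}|$ for all $n\le 0$; moreover $a^1_n=a^1_{-n}$ and $a^2_n=-a^2_{-n+1}$ for all $n\in\mathbb Z$. (ii) The equation in force variables $$x_{n+1}-2x_n+x_{n-1}=x_n|x_n|^{\frac1\alpha-1}-4x_n,\qquad n\in\mathbb Z$$ (where the first term on the right is $0$ if $x_n=0$), has two solutions $x^1,x^2$ such that, for $i=1,2$, $\lim_{n\to\pm\infty}x^i_n=0$, $x^i_n>x^i_{n-1}>0$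 for all $n\le 0$, and $x^i_0>4^{\alpha/(1-\alpha)}$; moreover $x^1_n=x^1_{-n+1}$ and $x^2_n=x^2_{-n}$ for all $n\in\mathbb Z$. (iii) For $s=-1$, the only bounded solution of $(E_{-1})$ is $a_n=0$ for all $n\in\mathbb Z$. -/

import Mathlib

open Filter Topology

noncomputable section

/-- The discrete `p`-Laplacian of a real sequence indexed by the integers. -/
def discretePLaplacian (p : ℝ) (a : ℤ → ℝ) (n : ℤ) : ℝ :=
  (a (n + 1) - a n) * |a (n + 1) - a n| ^ (p - 2)
    - (a n - a (n - 1)) * |a n - a (n - 1)| ^ (p - 2)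

/-- The stationary DpS equation `-s a_n = (Δ_p a)_n` for all integers `n`. -/
def IsStationaryDpS (p s : ℝ) (a : ℤ → ℝ) : Prop :=
  ∀ n : ℤ, -s * a n = discretePLaplacian p a n

/-- The sequence is homoclinic to `0`. -/
def IsHomoclinicToZero (a : ℤ → ℝ) : Prop :=
  Tendsto a atTop (𝓝 0) ∧ Tendsto a atBot (𝓝 0)

/-- The odd power function `P_β(x) = x |x|^(β-1)`. -/
def oddPower (β x : ℝ) : ℝ := x * |x| ^ (β - 1)

/-- The stationary equation in force variables, `(Δ x)_n = q(x_n)`, with the usual discrete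
Laplacian `Δ` and `q(x) = P_{1/α}(x) - 4 x`. -/
def IsForceSolution (α : ℝ) (x : ℤ → ℝ) : Prop :=
  ∀ n : ℤ, x (n + 1) - 2 * x n + x (n - 1) = oddPower (1 / α) (x n) - 4 * x n

end

/-!
Write a staggered sequence as `a_n = (-1)^n u_n` with `u > 0`. The equation for `s = 1` becomes the
fixed point equation `u = T u` with `(T u)_n = (u_{n+1} + u_n)^(p-1) + (u_n + u_{n-1})^(p-1)`, and
`x_n = (u_{n+1} + u_n)^(p-1)` solves the equation in force variables. So parts (i) and (ii) both
come from two positive fixed points of `T`, symmetric about `0` and about `1 / 2`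
(`exists_profile`).

The fixed points are found variationally. `p T` is the gradient of the energy
`Φ(u) = ∑ (u_{n+1} + u_n)^p`. On the set of symmetric unimodal sequences in the unit ball of `ℓ²`,
unimodality forces `u_n ≤ |n|^(-1/2)`. As `p > 2`, the series for `Φ` is dominated uniformly, so
`Φ` is continuous for pointwise convergence, the set is compact by Tychonoff's theorem, and `Φ`
attains its maximum (`exists_maximizer`). No Lagrange multiplier argument relative to the cone is
needed: `T` maps the cone into itself, so `T u / ‖T u‖` is a competitor of the maximizer `u`, and
convexity of `Φ` yields `‖T u‖ ≤ ⟨T u, u⟩` with `‖u‖ ≤ 1`. This is the equality case of the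
Cauchy–Schwarz inequality, so `T u = ‖T u‖ u` (`exists_eigen`); since `T` is homogeneous of degree
`p - 1 ≠ 1`, a multiple of `u` is a fixed point. Positivity and strict monotonicity follow from the
fixed point equation.

For `s = -1` the differences `y_n = a_n - a_{n-1}` and the forces `F_n = y_n |y_n|^(p-2)` have equal
signs and satisfy `F_{n+1} + F_{n-1} = 2 F_n + y_n`, which is impossible near the supremum of `|F|`
unless `F = 0` (`eq_zero_of_bounded`).
-/

/-! ### Symmetric unimodal sequences -/

/-- The cone of nonnegative sequences on `ℤ` that are symmetric about `c / 2` and nondecreasing up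
to index `0`. It is used for `c = 0` (one central site) and `c = 1` (two central sites), where
these are the sequences decreasing away from their centre. -/
def IsSymmUnimodal (c : ℤ) (u : ℤ → ℝ) : Prop :=
  (∀ n, 0 ≤ u n) ∧ (∀ n, u (c - n) = u n) ∧ ∀ n ≤ 0, u (n - 1) ≤ u n

/-- The sum of `u` over the two endpoints of the bond from `n` to `n + 1`. -/
def bondSum (u : ℤ → ℝ) (n : ℤ) : ℝ := u (n + 1) + u n

/-- The operator `u ↦ ((u_{n+1} + u_n)^(p-1) + (u_n + u_{n-1})^(p-1))_n`, which for nonnegative `u`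
is the negative `p`-Laplacian of the staggered sequence `(-1)^n u_n`, up to the factor `(-1)^n`. -/
noncomputable def staggeredOp (p : ℝ) (u : ℤ → ℝ) (n : ℤ) : ℝ :=
  bondSum u n ^ (p - 1) + bondSum u (n - 1) ^ (p - 1)

/-- The part of the cone of symmetric unimodal sequences in the closed unit ball of `ℓ²`. The norm
bound is imposed on finite partial sums, which makes the set visibly closed for pointwise
convergence. -/
def unimodalBall (c : ℤ) : Set (ℤ → ℝ) :=
  {u | IsSymmUnimodal c u ∧ ∀ s : Finset ℤ, ∑ n ∈ s, u n ^ 2 ≤ 1}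

lemma bondSum_nonneg {u : ℤ → ℝ} (hu : ∀ n, 0 ≤ u n) (n : ℤ) : 0 ≤ bondSum u n :=
  add_nonneg (hu _) (hu _)

lemma staggeredOp_nonneg {p : ℝ} {u : ℤ → ℝ} (hu : ∀ n, 0 ≤ u n) (n : ℤ) :
    0 ≤ staggeredOp p u n :=
  add_nonneg (Real.rpow_nonneg (bondSum_nonneg hu _) _) (Real.rpow_nonneg (bondSum_nonneg hu _) _)

lemma IsSymmUnimodal.smul {c : ℤ} {u : ℤ → ℝ} (hu : IsSymmUnimodal c u) {k : ℝ} (hk : 0 ≤ k) :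
    IsSymmUnimodal c (fun n => k * u n) :=
  ⟨fun n => mul_nonneg hk (hu.1 n), fun n => congrArg (k * ·) (hu.2.1 n),
    fun n hn => mul_le_mul_of_nonneg_left (hu.2.2 n hn) hk⟩

lemma IsSymmUnimodal.le_apply {c : ℤ} {u : ℤ → ℝ} (hu : IsSymmUnimodal c u) {n : ℤ}
    (hn : n ≤ 0) (k : ℕ) : u (n - k) ≤ u n := by
  induction k with
  | zero => simp
  | succ k ih =>
    refine le_trans ?_ ih
    have := hu.2.2 (n - k) (by omega)
    rwa [show n - ((k + 1 : ℕ) : ℤ) = n - k - 1 by push_cast; ring]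

lemma IsSymmUnimodal.apply_two_sub_le {c : ℤ} (hc : c = 0 ∨ c = 1) {u : ℤ → ℝ}
    (hu : IsSymmUnimodal c u) {n : ℤ} (hn : n ≤ 0) : u (n - 1) ≤ u (n + 1) := by
  rcases hn.lt_or_eq with h | rfl
  · have h1 := hu.2.2 (n + 1) (by omega)
    have h2 := hu.2.2 n hn
    rw [add_sub_cancel_right] at h1
    exact h2.trans h1
  · have h := hu.2.1 1
    have h2 := hu.2.2 0 le_rfl
    rcases hc with rfl | rfl
    · simp only [zero_sub, zero_add] at h ⊢; exact h.le
    · simp only [sub_self, zero_sub, zero_add] at h h2 ⊢; rwa [← h]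

lemma IsSymmUnimodal.bondSum_le {c : ℤ} (hc : c = 0 ∨ c = 1) {u : ℤ → ℝ}
    (hu : IsSymmUnimodal c u) {n : ℤ} (hn : n ≤ 0) : bondSum u (n - 1 - 1) ≤ bondSum u n := by
  have h1 := hu.apply_two_sub_le hc hn
  have h2 := hu.2.2 n hn
  have h3 := hu.2.2 (n - 1) (by omega)
  simp only [bondSum, sub_add_cancel]
  linarith

lemma IsSymmUnimodal.bondSum_symm {c : ℤ} {u : ℤ → ℝ}
    (hu : IsSymmUnimodal c u) (n : ℤ) : bondSum u (c - n) = bondSum u (n - 1) := by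
  have h1 := hu.2.1 n
  have h2 := hu.2.1 (n - 1)
  rw [show c - (n - 1) = c - n + 1 by ring] at h2
  simp only [bondSum, sub_add_cancel, h1, h2]
  ring

lemma IsSymmUnimodal.staggeredOp {p : ℝ} (hp : 2 < p) {c : ℤ} (hc : c = 0 ∨ c = 1) {u : ℤ → ℝ}
    (hu : IsSymmUnimodal c u) : IsSymmUnimodal c (staggeredOp p u) := by
  refine ⟨staggeredOp_nonneg hu.1, fun n => ?_, fun n hn => ?_⟩
  · have h := hu.bondSum_symm (n + 1)
    rw [add_sub_cancel_right, show c - (n + 1) = c - n - 1 by ring] at h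
    simp only [_root_.staggeredOp, hu.bondSum_symm n, h]
    ring
  · have := Real.rpow_le_rpow (bondSum_nonneg hu.1 _) (hu.bondSum_le hc hn)
      (by linarith : 0 ≤ p - 1)
    simp only [_root_.staggeredOp]
    linarith

/-! ### Compactness of the unimodal ball -/

lemma isCompact_unimodalBall (c : ℤ) : IsCompact (unimodalBall c) := by
  have hsub : unimodalBall c ⊆ Set.univ.pi fun _ => Set.Icc (0 : ℝ) 1 := by
    intro u hu n _
    have h := hu.2 {n}
    rw [Finset.sum_singleton] at h
    exact ⟨hu.1.1 n, by nlinarith⟩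
  refine (isCompact_univ_pi fun _ => isCompact_Icc).of_isClosed_subset ?_ hsub
  have e : unimodalBall c = ((⋂ n, {u : ℤ → ℝ | 0 ≤ u n}) ∩ ((⋂ n, {u : ℤ → ℝ | u (c - n) = u n}) ∩
      ⋂ n, ⋂ _ : n ≤ 0, {u : ℤ → ℝ | u (n - 1) ≤ u n})) ∩
      ⋂ s : Finset ℤ, {u : ℤ → ℝ | ∑ n ∈ s, u n ^ 2 ≤ 1} := by
    ext u
    simp only [unimodalBall, IsSymmUnimodal, Set.mem_ofPred_eq, Set.mem_inter_iff, Set.mem_iInter]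
  rw [e]
  refine ((isClosed_iInter fun n => ?_).inter ((isClosed_iInter fun n => ?_).inter
    (isClosed_iInter fun n => isClosed_iInter fun _ => ?_))).inter (isClosed_iInter fun s => ?_)
  · exact isClosed_le (by fun_prop) (by fun_prop)
  · exact isClosed_eq (by fun_prop) (by fun_prop)
  · exact isClosed_le (by fun_prop) (by fun_prop)
  · exact isClosed_le (by fun_prop) (by fun_prop)

lemma le_one_of_mem_unimodalBall {c : ℤ} {u : ℤ → ℝ} (hu : u ∈ unimodalBall c) (n : ℤ) :
    u n ≤ 1 := by
  have h := hu.2 {n}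
  rw [Finset.sum_singleton] at h
  nlinarith

lemma summable_sq_of_mem_unimodalBall {c : ℤ} {u : ℤ → ℝ} (hu : u ∈ unimodalBall c) :
    Summable fun n => u n ^ 2 :=
  summable_of_sum_le (fun _ => sq_nonneg _) hu.2

/-- A unimodal sequence in the unit ball of `ℓ²` decays at least like `|n|^(-1/2)`: the value at
`n` is a lower bound for at least `|n|` values. -/
lemma abs_mul_sq_le_one {c : ℤ} (hc : c = 0 ∨ c = 1) {u : ℤ → ℝ} (hu : u ∈ unimodalBall c)
    (n : ℤ) : |(n : ℝ)| * u n ^ 2 ≤ 1 := by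
  have key : ∀ k : ℕ, ((k : ℝ) + 1) * u (-k) ^ 2 ≤ 1 := by
    intro k
    have h := hu.2 ((Finset.range (k + 1)).map ⟨fun i : ℕ => -(i : ℤ), fun i j h => by simpa using h⟩)
    rw [Finset.sum_map] at h
    refine le_trans ?_ h
    have h2 : ∀ i ∈ Finset.range (k + 1), u (-k) ^ 2 ≤ u (-(i : ℤ)) ^ 2 := by
      intro i hi
      have h3 := hu.1.le_apply (n := -(i : ℤ)) (by omega) (k - i)
      rw [show -(i : ℤ) - ((k - i : ℕ) : ℤ) = -k by
        have := Finset.mem_range.1 hi; omega] at h3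
      exact pow_le_pow_left₀ (hu.1.1 _) h3 2
    have := Finset.card_nsmul_le_sum _ _ _ h2
    rw [Finset.card_range, nsmul_eq_mul, Nat.cast_add, Nat.cast_one] at this
    exact this
  rcases le_total n 0 with h | h
  · obtain ⟨k, rfl⟩ : ∃ k : ℕ, n = -(k : ℤ) := ⟨n.natAbs, by omega⟩
    have := key k
    have h2 := sq_nonneg (u (-(k : ℤ)))
    simp only [Int.cast_neg, Int.cast_natCast, abs_neg, Nat.abs_cast]
    nlinarith
  · rcases h.lt_or_eq with h | rfl
    · obtain ⟨k, hk⟩ : ∃ k : ℕ, c - n = -(k : ℤ) := ⟨(n - c).natAbs, by omega⟩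
      have h1 := key k
      rw [← hk, hu.1.2.1] at h1
      have h2 : |(n : ℝ)| ≤ (k : ℝ) + 1 := by
        rw [abs_of_pos (by exact_mod_cast h)]
        have : n ≤ (k : ℤ) + 1 := by omega
        exact_mod_cast this
      exact (mul_le_mul_of_nonneg_right h2 (sq_nonneg _)).trans h1
    · simp

/-! ### The functional `∑ (u_{n+1} + u_n)^p` -/

/-- The functional `∑ (u_{n+1} + u_n)^p`, whose gradient is `p` times the staggered operator. -/
noncomputable def bondEnergy (p : ℝ) (u : ℤ → ℝ) : ℝ := ∑' n, bondSum u n ^ p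

/-- A common summable majorant for `|u_n|^p` on the unimodal ball; the term at `0` carries the
bound `1` there, where the decay rate gives none. -/
noncomputable def decayMajorant (p : ℝ) (n : ℤ) : ℝ := |(n : ℝ)| ^ (-(p / 2)) + if n = 0 then 1 else 0

lemma summable_decayMajorant {p : ℝ} (hp : 2 < p) : Summable (decayMajorant p) := by
  refine (Real.summable_abs_int_rpow (by linarith)).add ?_
  exact summable_of_hasFiniteSupport ((Set.finite_singleton (0 : ℤ)).subset fun n => by
    simp only [Function.mem_support, Set.mem_singleton_iff]
    intro h; by_contra h0; simp [h0] at h)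

lemma rpow_le_decayMajorant {p : ℝ} (hp : 2 < p) {c : ℤ} (hc : c = 0 ∨ c = 1) {u : ℤ → ℝ}
    (hu : u ∈ unimodalBall c) (n : ℤ) : u n ^ p ≤ decayMajorant p n := by
  by_cases h : n = 0
  · subst h
    have h1 := Real.rpow_le_one (hu.1.1 0) (le_one_of_mem_unimodalBall hu 0)
      (by linarith : 0 ≤ p)
    have h2 : 0 ≤ |((0 : ℤ) : ℝ)| ^ (-(p / 2)) := Real.rpow_nonneg (abs_nonneg _) _
    simp only [decayMajorant, if_true]
    linarith
  · have h0 : 0 < |(n : ℝ)| := abs_pos.2 (by exact_mod_cast h)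
    have h1 := abs_mul_sq_le_one hc hu n
    have h2 : u n ^ 2 ≤ |(n : ℝ)|⁻¹ := by
      rw [← one_div, le_div_iff₀ h0]; linarith
    have h3 := Real.rpow_le_rpow (sq_nonneg _) h2 (by linarith : 0 ≤ p / 2)
    rw [← Real.rpow_natCast, ← Real.rpow_mul (hu.1.1 n), Real.inv_rpow h0.le,
      ← Real.rpow_neg h0.le] at h3
    simp only [decayMajorant, h, if_false, add_zero]
    convert h3 using 2
    push_cast; ring

lemma bondSum_rpow_le {p : ℝ} (hp : 2 < p) {c : ℤ} (hc : c = 0 ∨ c = 1) {u : ℤ → ℝ}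
    (hu : u ∈ unimodalBall c) (n : ℤ) :
    bondSum u n ^ p ≤ 2 ^ p * (decayMajorant p (n + 1) + decayMajorant p n) := by
  have h0 : 0 ≤ p := by linarith
  have h1 : bondSum u n ≤ 2 * max (u (n + 1)) (u n) := by
    have := le_max_left (u (n + 1)) (u n)
    have := le_max_right (u (n + 1)) (u n)
    simp only [bondSum]; linarith
  have hm : 0 ≤ max (u (n + 1)) (u n) := le_max_of_le_right (hu.1.1 n)
  refine (Real.rpow_le_rpow (bondSum_nonneg hu.1.1 n) h1 h0).trans ?_
  rw [Real.mul_rpow (by norm_num) hm]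
  refine mul_le_mul_of_nonneg_left ?_ (Real.rpow_nonneg (by norm_num) _)
  have a1 := rpow_le_decayMajorant hp hc hu (n + 1)
  have a2 := rpow_le_decayMajorant hp hc hu n
  have b1 := Real.rpow_nonneg (hu.1.1 (n + 1)) p
  have b2 := Real.rpow_nonneg (hu.1.1 n) p
  rcases max_choice (u (n + 1)) (u n) with h | h <;> rw [h] <;> linarith

lemma Summable.int_shift {f : ℤ → ℝ} (hf : Summable f) (k : ℤ) : Summable fun n => f (n + k) :=
  (Equiv.addRight k).summable_iff.2 hf

lemma summable_bondMajorant {p : ℝ} (hp : 2 < p) :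
    Summable fun n => 2 ^ p * (decayMajorant p (n + 1) + decayMajorant p n) :=
  (((summable_decayMajorant hp).int_shift 1).add (summable_decayMajorant hp)).mul_left _

lemma continuousOn_bondEnergy {p : ℝ} (hp : 2 < p) {c : ℤ} (hc : c = 0 ∨ c = 1) :
    ContinuousOn (bondEnergy p) (unimodalBall c) := by
  refine continuousOn_tsum (fun n => ?_) (summable_bondMajorant hp) fun n u hu => ?_
  · refine Continuous.continuousOn ?_
    refine Continuous.rpow_const ?_ fun _ => Or.inr (by linarith)
    simp only [bondSum]; fun_prop
  · rw [Real.norm_of_nonneg (Real.rpow_nonneg (bondSum_nonneg hu.1.1 n) _)]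
    exact bondSum_rpow_le hp hc hu n

lemma summable_bondSum_rpow {p : ℝ} (hp : 2 < p) {c : ℤ} (hc : c = 0 ∨ c = 1) {u : ℤ → ℝ}
    (hu : u ∈ unimodalBall c) : Summable fun n => bondSum u n ^ p :=
  Summable.of_nonneg_of_le (fun n => Real.rpow_nonneg (bondSum_nonneg hu.1.1 n) _)
    (bondSum_rpow_le hp hc hu) (summable_bondMajorant hp)

/-- The energy attains a maximum on the unimodal ball, at a sequence that is not zero. -/
lemma exists_maximizer {p : ℝ} (hp : 2 < p) {c : ℤ} (hc : c = 0 ∨ c = 1) :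
    ∃ u ∈ unimodalBall c, (∀ v ∈ unimodalBall c, bondEnergy p v ≤ bondEnergy p u) ∧
      ∃ n, u n ≠ 0 := by
  classical
  -- a competitor of positive energy, supported on the central sites
  let t : ℤ → ℝ := fun n => if n ∈ ({0, c} : Finset ℤ) then 1 / 2 else 0
  have ht : t ∈ unimodalBall c := by
    refine ⟨⟨fun n => ?_, fun n => ?_, fun n hn => ?_⟩, fun s => ?_⟩
    · simp only [t]; split_ifs <;> norm_num
    · simp only [t, Finset.mem_insert, Finset.mem_singleton]
      congr 1
      simp only [eq_iff_iff]; omega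
    · have : n - 1 ∉ ({0, c} : Finset ℤ) := by
        simp only [Finset.mem_insert, Finset.mem_singleton]; omega
      simp only [t, this, if_false]; split_ifs <;> norm_num
    · calc ∑ n ∈ s, t n ^ 2 = ∑ n ∈ s, if n ∈ ({0, c} : Finset ℤ) then (1 / 4 : ℝ) else 0 :=
            Finset.sum_congr rfl fun n _ => by simp only [t]; split_ifs <;> norm_num
        _ = ((s.filter (· ∈ ({0, c} : Finset ℤ))).card : ℝ) * (1 / 4) := by
            rw [← Finset.sum_filter, Finset.sum_const, nsmul_eq_mul]
        _ ≤ 1 := by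
            have h1 : (s.filter (· ∈ ({0, c} : Finset ℤ))).card ≤ 2 :=
              (Finset.card_le_card fun n hn => (Finset.mem_filter.1 hn).2).trans
                Finset.card_le_two
            have h2 : ((s.filter (· ∈ ({0, c} : Finset ℤ))).card : ℝ) ≤ 2 := by exact_mod_cast h1
            linarith
  obtain ⟨u, hu, hmax⟩ := (isCompact_unimodalBall c).exists_isMaxOn ⟨t, ht⟩
    (continuousOn_bondEnergy hp hc)
  refine ⟨u, hu, fun v hv => hmax hv, ?_⟩
  by_contra! h0
  have h1 : bondEnergy p u = 0 := by
    simp [bondEnergy, bondSum, h0, Real.zero_rpow (by linarith : p ≠ 0)]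
  have h2 : 0 < bondEnergy p t := by
    refine (summable_bondSum_rpow hp hc ht).tsum_pos
      (fun n => Real.rpow_nonneg (bondSum_nonneg ht.1.1 n) _) 0 (Real.rpow_pos_of_pos ?_ _)
    have ha : t 0 = 1 / 2 := by simp [t]
    exact add_pos_of_nonneg_of_pos (ht.1.1 _) (by rw [ha]; norm_num)
  exact absurd (hmax ht) (by simp only [Set.mem_ofPred_eq, h1, not_le]; exact h2)

/-! ### The Euler–Lagrange equation -/

lemma tangent_le_rpow {p : ℝ} (hp : 1 < p) {a b : ℝ} (ha : 0 ≤ a) (hb : 0 ≤ b) :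
    a ^ p + p * (a ^ (p - 1) * (b - a)) ≤ b ^ p := by
  rcases ha.eq_or_lt with rfl | ha
  · rw [Real.zero_rpow (by linarith), Real.zero_rpow (by linarith)]
    simpa using Real.rpow_nonneg hb p
  · have h := one_add_mul_self_le_rpow_one_add (s := b / a - 1)
      (by have := div_nonneg hb ha.le; linarith) hp.le
    rw [add_sub_cancel, Real.div_rpow hb ha.le, le_div_iff₀ (Real.rpow_pos_of_pos ha p)] at h
    refine le_trans (le_of_eq ?_) h
    rw [Real.rpow_sub_one ha.ne']
    field_simp

lemma Summable.mul_of_sq {ι : Type*} {f g : ι → ℝ} (hf : Summable fun i => f i ^ 2)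
    (hg : Summable fun i => g i ^ 2) : Summable fun i => f i * g i := by
  refine Summable.of_norm_bounded (hf.add hg) fun i => ?_
  rw [Real.norm_eq_abs, abs_le]
  constructor <;> nlinarith [sq_nonneg (f i + g i), sq_nonneg (f i - g i)]

lemma Summable.add_sq {ι : Type*} {f g : ι → ℝ} (hf : Summable fun i => f i ^ 2)
    (hg : Summable fun i => g i ^ 2) : Summable fun i => (f i + g i) ^ 2 := by
  convert (hf.add hg).add ((Summable.mul_of_sq hf hg).mul_left 2) using 2
  ring

/-- Summation by parts on `ℤ`. -/
lemma tsum_mul_bondSum {w f : ℤ → ℝ} (hw : Summable fun n => w n ^ 2)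
    (hf : Summable fun n => f n ^ 2) :
    ∑' n, w n * bondSum f n = ∑' n, (w n + w (n - 1)) * f n := by
  have h1 : Summable fun n => w n * f (n + 1) := Summable.mul_of_sq hw (hf.int_shift 1)
  have h2 : Summable fun n => w n * f n := Summable.mul_of_sq hw hf
  have h3 : Summable fun n => w (n - 1) * f n := Summable.mul_of_sq (hw.int_shift (-1)) hf
  have e : ∑' n, w n * f (n + 1) = ∑' n, w (n - 1) * f n := by
    rw [← (Equiv.addRight (1 : ℤ)).tsum_eq fun n => w (n - 1) * f n]
    simp
  simp only [bondSum, mul_add, add_mul]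
  rw [h1.tsum_add h2, h2.tsum_add h3, e, add_comm]

lemma summable_bondSum_sq {u : ℤ → ℝ} (hu : Summable fun n => u n ^ 2) :
    Summable fun n => bondSum u n ^ 2 :=
  Summable.add_sq (hu.int_shift 1) hu

lemma summable_force_sq {p : ℝ} (hp : 2 < p) {c : ℤ} {u : ℤ → ℝ} (hu : u ∈ unimodalBall c) :
    Summable fun n => (bondSum u n ^ (p - 1)) ^ 2 := by
  refine Summable.of_nonneg_of_le (fun n => sq_nonneg _) (fun n => ?_)
    ((summable_bondSum_sq (summable_sq_of_mem_unimodalBall hu)).mul_left (((2 : ℝ) ^ (p - 2)) ^ 2))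
  have h0 := bondSum_nonneg hu.1.1 n
  have h2 : bondSum u n ≤ 2 := by
    have := le_one_of_mem_unimodalBall hu n
    have := le_one_of_mem_unimodalBall hu (n + 1)
    simp only [bondSum]; linarith
  rw [← mul_pow]
  refine pow_le_pow_left₀ (Real.rpow_nonneg h0 _) ?_ 2
  have e : bondSum u n ^ (p - 1) = bondSum u n ^ (p - 2) * bondSum u n := by
    nth_rewrite 3 [← Real.rpow_one (bondSum u n)]
    rw [← Real.rpow_add_of_nonneg h0 (by linarith) zero_le_one]
    ring_nf
  rw [e]
  exact mul_le_mul_of_nonneg_right (Real.rpow_le_rpow h0 h2 (by linarith)) h0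

lemma summable_staggeredOp_sq {p : ℝ} (hp : 2 < p) {c : ℤ} {u : ℤ → ℝ}
    (hu : u ∈ unimodalBall c) : Summable fun n => staggeredOp p u n ^ 2 :=
  Summable.add_sq (summable_force_sq hp hu) ((summable_force_sq hp hu).int_shift (-1))

/-- The energy lies above its tangent, whose slope is `p` times the staggered operator. -/
lemma bondEnergy_add_le {p : ℝ} (hp : 2 < p) {c : ℤ} (hc : c = 0 ∨ c = 1) {u v : ℤ → ℝ}
    (hu : u ∈ unimodalBall c) (hv : v ∈ unimodalBall c) :
    bondEnergy p u + p * (∑' n, staggeredOp p u n * v n - ∑' n, staggeredOp p u n * u n) ≤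
      bondEnergy p v := by
  have hw := summable_force_sq hp hu
  have su := summable_sq_of_mem_unimodalBall hu
  have sv := summable_sq_of_mem_unimodalBall hv
  have h1 := Summable.mul_of_sq hw (summable_bondSum_sq sv)
  have h2 := Summable.mul_of_sq hw (summable_bondSum_sq su)
  have h3 := summable_bondSum_rpow hp hc hu
  simp only [staggeredOp]
  rw [← tsum_mul_bondSum hw su, ← tsum_mul_bondSum hw sv, ← h1.tsum_sub h2, ← tsum_mul_left,
    bondEnergy, ← h3.tsum_add ((h1.sub h2).mul_left p)]
  refine (h3.add ((h1.sub h2).mul_left p)).tsum_le_tsum (fun n => ?_)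
    (summable_bondSum_rpow hp hc hv)
  rw [← mul_sub]
  exact tangent_le_rpow (by linarith) (bondSum_nonneg hu.1.1 n) (bondSum_nonneg hv.1.1 n)

/-- A maximizer `u` of the energy satisfies an eigenvalue equation for the staggered operator `T`.
The normalized sequence `T u / ‖T u‖` is a competitor, so the tangent inequality gives
`‖T u‖ ≤ ⟨T u, u⟩`, the equality case of the Cauchy–Schwarz inequality. -/
lemma exists_eigen {p : ℝ} (hp : 2 < p) {c : ℤ} (hc : c = 0 ∨ c = 1) :
    ∃ u ∈ unimodalBall c, ∃ N : ℝ, 0 < N ∧ (∀ n, staggeredOp p u n = N * u n) ∧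
      ∃ n, u n ≠ 0 := by
  obtain ⟨u, hu, hmax, m, hm⟩ := exists_maximizer hp hc
  have sT := summable_staggeredOp_sq hp hu
  have su := summable_sq_of_mem_unimodalBall hu
  have hTm : 0 < staggeredOp p u m := by
    refine add_pos_of_pos_of_nonneg (Real.rpow_pos_of_pos ?_ _)
      (Real.rpow_nonneg (bondSum_nonneg hu.1.1 _) _)
    exact add_pos_of_nonneg_of_pos (hu.1.1 _) ((hu.1.1 m).lt_of_ne' hm)
  set S := ∑' n, staggeredOp p u n ^ 2 with hS
  have hSpos : 0 < S := sT.tsum_pos (fun _ => sq_nonneg _) m (pow_pos hTm 2)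
  set N := √S with hN
  have hNpos : 0 < N := Real.sqrt_pos.2 hSpos
  have hNsq : N ^ 2 = S := Real.sq_sqrt hSpos.le
  have hv : (fun n => N⁻¹ * staggeredOp p u n) ∈ unimodalBall c := by
    refine ⟨(hu.1.staggeredOp hp hc).smul (inv_nonneg.2 hNpos.le), fun s => ?_⟩
    have := sT.sum_le_tsum s (fun _ _ => sq_nonneg _)
    simp only [mul_pow]
    rw [← Finset.mul_sum, inv_pow, hNsq, inv_mul_le_one₀ hSpos]
    exact this
  have h := (bondEnergy_add_le hp hc hu hv).trans (hmax _ hv)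
  have e : ∑' n, staggeredOp p u n * (N⁻¹ * staggeredOp p u n) = N := by
    have : ∀ n, staggeredOp p u n * (N⁻¹ * staggeredOp p u n) =
      N⁻¹ * staggeredOp p u n ^ 2 := fun n => by ring
    simp only [this]
    rw [tsum_mul_left, ← hS, ← hNsq]
    field_simp
  rw [e] at h
  have sTu := Summable.mul_of_sq sT su
  have hle : N ≤ ∑' n, staggeredOp p u n * u n := by
    by_contra! hlt
    have := mul_pos (by linarith : 0 < p) (sub_pos.2 hlt)
    linarith
  have hu1 : ∑' n, u n ^ 2 ≤ 1 := su.tsum_le_of_sum_le hu.2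
  have hexp : ∀ n, (staggeredOp p u n - N * u n) ^ 2 = staggeredOp p u n ^ 2 -
      2 * N * (staggeredOp p u n * u n) + N ^ 2 * u n ^ 2 := fun n => by ring
  have sd : Summable fun n => (staggeredOp p u n - N * u n) ^ 2 := by
    simp only [hexp]
    exact (sT.sub (sTu.mul_left _)).add (su.mul_left _)
  have h0 : ∑' n, (staggeredOp p u n - N * u n) ^ 2 ≤ 0 := by
    simp only [hexp]
    rw [(sT.sub (sTu.mul_left _)).tsum_add (su.mul_left _), sT.tsum_sub (sTu.mul_left _),
      tsum_mul_left, tsum_mul_left, ← hS, ← hNsq]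
    nlinarith [mul_le_mul_of_nonneg_left hle hNpos.le,
      mul_le_mul_of_nonneg_left hu1 (sq_nonneg N)]
  refine ⟨u, hu, N, hNpos, fun n => ?_, m, hm⟩
  have h1 := sd.le_tsum n (fun _ _ => sq_nonneg _)
  have h2 : (staggeredOp p u n - N * u n) ^ 2 = 0 := le_antisymm (h1.trans h0) (sq_nonneg _)
  exact sub_eq_zero.1 (pow_eq_zero_iff two_ne_zero |>.1 h2)

/-! ### The amplitude profile -/

lemma tendsto_zero_of_summable_sq {u : ℤ → ℝ} (hu : Summable fun n => u n ^ 2) :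
    IsHomoclinicToZero u := by
  have h := hu.tendsto_cofinite_zero
  have h2 : Tendsto u cofinite (𝓝 0) := by
    rw [tendsto_zero_iff_abs_tendsto_zero]
    have := h.sqrt
    simp only [Real.sqrt_sq_eq_abs, Real.sqrt_zero] at this
    exact this
  rw [Int.cofinite_eq, tendsto_sup] at h2
  exact ⟨h2.2, h2.1⟩

/-- A nonzero nonnegative fixed point of the staggered operator is positive: a zero forces both
neighbours to vanish. -/
lemma pos_of_staggeredOp_eq {p : ℝ} (hp : 2 < p) {u : ℤ → ℝ} (hu : ∀ n, 0 ≤ u n)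
    (heq : ∀ n, staggeredOp p u n = u n) {m : ℤ} (hm : u m ≠ 0) (n : ℤ) : 0 < u n := by
  have hp1 : p - 1 ≠ 0 := by linarith
  have key : ∀ n, u n = 0 → u (n + 1) = 0 ∧ u (n - 1) = 0 := by
    intro n hn
    have h := heq n
    rw [hn, staggeredOp] at h
    have b1 := bondSum_nonneg hu n
    have b2 := bondSum_nonneg hu (n - 1)
    obtain ⟨h1, h2⟩ := (add_eq_zero_iff_of_nonneg (Real.rpow_nonneg b1 _)
      (Real.rpow_nonneg b2 _)).1 h
    rw [Real.rpow_eq_zero b1 hp1, bondSum, hn, add_zero] at h1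
    rw [Real.rpow_eq_zero b2 hp1, bondSum, sub_add_cancel, hn, zero_add] at h2
    exact ⟨h1, h2⟩
  refine (hu n).lt_of_ne' fun h0 => hm ?_
  exact Int.inductionOn' m n h0 (fun k _ hk => (key k hk).1) (fun k _ hk => (key k hk).2)

/-- A positive unimodal fixed point of the staggered operator that decays is strictly monotone up
to its centre: equality at one step forces equality at the previous one, hence a constant tail. -/
lemma strict_of_staggeredOp_eq {p : ℝ} (hp : 2 < p) {c : ℤ} (hc : c = 0 ∨ c = 1) {u : ℤ → ℝ}
    (hu : IsSymmUnimodal c u) (heq : ∀ n, staggeredOp p u n = u n) (hpos : ∀ n, 0 < u n)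
    (hlim : Tendsto u atBot (𝓝 0)) {n : ℤ} (hn : n ≤ 0) : u (n - 1) < u n := by
  refine (hu.2.2 n hn).lt_of_ne fun h => ?_
  have step : ∀ m ≤ 0, u (m - 1) = u m → u (m - 1 - 1) = u (m - 1) := by
    intro m hm h
    have e := (heq (m - 1)).trans (h.trans (heq m).symm)
    simp only [staggeredOp] at e
    rw [add_comm, add_left_inj, Real.rpow_left_inj (bondSum_nonneg hu.1 _)
      (bondSum_nonneg hu.1 _) (by linarith)] at e
    simp only [bondSum, sub_add_cancel] at e
    have h1 := hu.2.2 (m - 1) (by omega)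
    have h2 := hu.apply_two_sub_le hc hm
    linarith
  have all : ∀ k : ℕ, u (n - k - 1) = u (n - k) := by
    intro k
    induction k with
    | zero => simpa using h
    | succ k ih =>
      have := step (n - k) (by omega) ih
      rwa [show n - ((k + 1 : ℕ) : ℤ) = n - k - 1 by push_cast; ring]
  have const : ∀ k : ℕ, u (n - k) = u n := by
    intro k
    induction k with
    | zero => simp
    | succ k ih =>
      rw [show n - ((k + 1 : ℕ) : ℤ) = n - k - 1 by push_cast; ring, all k, ih]
  have h1 : Tendsto (fun k : ℕ => u (n - k)) atTop (𝓝 0) :=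
    hlim.comp (tendsto_atBot_add_const_left _ n
      (tendsto_neg_atTop_atBot.comp tendsto_natCast_atTop_atTop))
  simp only [const] at h1
  exact (hpos n).ne (tendsto_nhds_unique h1 tendsto_const_nhds)

/-- The amplitudes of the two staggered solutions, centred at a site (`c = 0`) or at a bond
(`c = 1`). They are multiples of maximizers of the energy; the homogeneity of degree `p - 1 > 1`
of the staggered operator absorbs the eigenvalue. -/
lemma exists_profile {p : ℝ} (hp : 2 < p) {c : ℤ} (hc : c = 0 ∨ c = 1) :
    ∃ u : ℤ → ℝ, (∀ n, 0 < u n) ∧ (∀ n, u (c - n) = u n) ∧ (∀ n ≤ 0, u (n - 1) < u n) ∧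
      IsHomoclinicToZero u ∧ ∀ n, staggeredOp p u n = u n := by
  obtain ⟨u, hu, N, hN, heq, m, hm⟩ := exists_eigen hp hc
  -- `k ^ (p - 1) * N = k`
  let k : ℝ := N ^ (-(1 / (p - 2)))
  have hk : 0 < k := Real.rpow_pos_of_pos hN _
  have hp2 : p - 2 ≠ 0 := by linarith
  have hkN : k ^ (p - 1) * N = k := by
    have h1 : k ^ (p - 1) = N ^ (-(1 / (p - 2)) * (p - 1)) := (Real.rpow_mul hN.le _ _).symm
    have h2 : N ^ (-(1 / (p - 2)) * (p - 1) + 1) = k := by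
      refine congrArg (N ^ ·) ?_
      field_simp; ring
    rw [h1, ← h2, Real.rpow_add_one hN.ne']
  have hv := hu.1.smul hk.le
  have hb : ∀ n, bondSum (fun n => k * u n) n = k * bondSum u n := fun n => by
    simp only [bondSum]; ring
  have hveq : ∀ n, staggeredOp p (fun n => k * u n) n = k * u n := by
    intro n
    have h := heq n
    simp only [staggeredOp, hb] at h ⊢
    rw [Real.mul_rpow hk.le (bondSum_nonneg hu.1.1 _), Real.mul_rpow hk.le
      (bondSum_nonneg hu.1.1 _), ← mul_add, h, ← mul_assoc, hkN]
  have hpos := pos_of_staggeredOp_eq hp hv.1 hveq (m := m) (mul_ne_zero hk.ne' hm)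
  have hlim : IsHomoclinicToZero fun n => k * u n := by
    refine tendsto_zero_of_summable_sq ?_
    simp only [mul_pow]
    exact (summable_sq_of_mem_unimodalBall hu).mul_left _
  exact ⟨_, hpos, hv.2.1, fun n hn => strict_of_staggeredOp_eq hp hc hv hveq hpos hlim.2 hn,
    hlim, hveq⟩

/-! ### From amplitudes to staggered and force solutions -/

lemma sign_mul_abs_rpow {p : ℝ} (hp : 2 < p) {ε s : ℝ} (hε : |ε| = 1) (hs : 0 ≤ s) :
    ε * s * |ε * s| ^ (p - 2) = ε * s ^ (p - 1) := by
  have h := Real.rpow_add_of_nonneg hs zero_le_one (by linarith : 0 ≤ p - 2)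
  rw [Real.rpow_one, show 1 + (p - 2) = p - 1 by ring] at h
  rw [abs_mul, hε, one_mul, abs_of_nonneg hs, h, mul_assoc]

lemma isStationaryDpS_staggered {p : ℝ} (hp : 2 < p) {u : ℤ → ℝ} (hu : ∀ n, 0 < u n)
    (heq : ∀ n, staggeredOp p u n = u n) :
    IsStationaryDpS p 1 fun n => (-1 : ℝ) ^ n * u n := by
  intro n
  have hb := bondSum_nonneg fun n => (hu n).le
  have h0 : (-1 : ℝ) ≠ 0 := by norm_num
  have e1 : (-1 : ℝ) ^ (n + 1) * u (n + 1) - (-1 : ℝ) ^ n * u n =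
      -(-1 : ℝ) ^ n * bondSum u n := by
    rw [zpow_add_one₀ h0, bondSum]; ring
  have e2 : (-1 : ℝ) ^ n * u n - (-1 : ℝ) ^ (n - 1) * u (n - 1) =
      (-1 : ℝ) ^ n * bondSum u (n - 1) := by
    rw [zpow_sub_one₀ h0, bondSum, sub_add_cancel]; ring
  simp only [discretePLaplacian, e1, e2]
  rw [sign_mul_abs_rpow hp (by rw [abs_neg, abs_neg_one_zpow]) (hb _),
    sign_mul_abs_rpow hp (abs_neg_one_zpow n) (hb _), ← heq n, staggeredOp]
  ring

lemma isHomoclinicToZero_staggered {u : ℤ → ℝ} (hu : IsHomoclinicToZero u) :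
    IsHomoclinicToZero fun n => (-1 : ℝ) ^ n * u n := by
  have h : ∀ l : Filter ℤ, Tendsto u l (𝓝 0) →
      Tendsto (fun n => (-1 : ℝ) ^ n * u n) l (𝓝 0) := fun l hl => by
    rw [tendsto_zero_iff_abs_tendsto_zero] at hl ⊢
    refine hl.congr fun n => ?_
    simp [abs_mul]
  exact ⟨h _ hu.1, h _ hu.2⟩

lemma isForceSolution_bondSum {p : ℝ} (hp : 2 < p) {u : ℤ → ℝ} (hu : ∀ n, 0 < u n)
    (heq : ∀ n, staggeredOp p u n = u n) (k : ℤ) :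
    IsForceSolution (p - 1) fun n => bondSum u (n + k) ^ (p - 1) := by
  intro n
  have hb : ∀ n, 0 < bondSum u n := fun n => add_pos (hu _) (hu _)
  have hx : 0 < bondSum u (n + k) ^ (p - 1) := Real.rpow_pos_of_pos (hb _) _
  have h1 := heq (n + k + 1)
  have h2 := heq (n + k)
  have e : oddPower (1 / (p - 1)) (bondSum u (n + k) ^ (p - 1)) = bondSum u (n + k) := by
    rw [oddPower, abs_of_pos hx, Real.rpow_sub_one hx.ne', mul_div_cancel₀ _ hx.ne',
      ← Real.rpow_mul (hb _).le, mul_one_div_cancel (by linarith), Real.rpow_one]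
  simp only [staggeredOp, add_sub_cancel_right] at h1 h2
  simp only [e, show n + 1 + k = n + k + 1 by ring, show n - 1 + k = n + k - 1 by ring]
  nth_rewrite 4 [bondSum]
  linarith

lemma isHomoclinicToZero_bondSum {p : ℝ} (hp : 2 < p) {u : ℤ → ℝ} (hu : IsHomoclinicToZero u)
    (k : ℤ) : IsHomoclinicToZero fun n => bondSum u (n + k) ^ (p - 1) := by
  have h : ∀ l : Filter ℤ, Tendsto (fun n => u (n + k + 1)) l (𝓝 0) →
      Tendsto (fun n => u (n + k)) l (𝓝 0) →
      Tendsto (fun n => bondSum u (n + k) ^ (p - 1)) l (𝓝 0) := fun l h1 h2 => by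
    have := (h1.add h2).rpow_const (p := p - 1) (Or.inr (by linarith))
    rwa [add_zero, Real.zero_rpow (by linarith)] at this
  have s1 : ∀ j : ℤ, Tendsto (fun n : ℤ => n + j) atTop atTop :=
    fun j => tendsto_atTop_add_const_right _ j tendsto_id
  have s2 : ∀ j : ℤ, Tendsto (fun n : ℤ => n + j) atBot atBot :=
    fun j => tendsto_atBot_add_const_right _ j tendsto_id
  exact ⟨h _ (hu.1.comp ((s1 1).comp (s1 k))) (hu.1.comp (s1 k)),
    h _ (hu.2.comp ((s2 1).comp (s2 k))) (hu.2.comp (s2 k))⟩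

/-- A peak of a positive force solution exceeds the positive fixed point `4 ^ (α / (1 - α))`. -/
lemma IsForceSolution.lt_apply_zero {α : ℝ} (hα : 1 < α) {x : ℤ → ℝ} (hx : IsForceSolution α x)
    (h0 : 0 < x 0) (h1 : x 1 ≤ x 0) (h2 : x (-1) < x 0) : (4 : ℝ) ^ (α / (1 - α)) < x 0 := by
  have h := hx 0
  rw [zero_add, zero_sub, oddPower, abs_of_pos h0] at h
  have h3 : x 0 ^ (1 / α - 1) < 4 := by
    have : x 0 * x 0 ^ (1 / α - 1) < x 0 * 4 := by linarith
    exact lt_of_mul_lt_mul_left this h0.le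
  have hneg : α / (1 - α) < 0 := div_neg_of_pos_of_neg (by linarith) (by linarith)
  have h4 := Real.rpow_lt_rpow_of_neg (Real.rpow_pos_of_pos h0 _) h3 hneg
  have hα0 : α ≠ 0 := by linarith
  have hα1 : 1 - α ≠ 0 := by linarith
  rwa [← Real.rpow_mul h0.le, show (1 / α - 1) * (α / (1 - α)) = 1 by field_simp,
    Real.rpow_one] at h4

/-! ### Absence of bounded solutions for `s = -1` -/

/-- For `s = -1` the forces `F_n` satisfy `F_{n+1} + F_{n-1} = 2 F_n + y_n`, where `y_n` has the sign
of `F_n`. Hence `2 |F_n| + |y_n| ≤ 2 sup |F|`, which keeps `|F|` away from its supremum unless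
`F = 0`. -/
lemma eq_zero_of_bounded {p : ℝ} (hp : 2 < p) {a : ℤ → ℝ} (ha : IsStationaryDpS p (-1) a)
    {C : ℝ} (hC : ∀ n, |a n| ≤ C) (n : ℤ) : a n = 0 := by
  let y : ℤ → ℝ := fun n => a n - a (n - 1)
  let F : ℤ → ℝ := fun n => y n * |y n| ^ (p - 2)
  have haF : ∀ n, a n = F (n + 1) - F n := fun n => by
    have := ha n
    simp only [discretePLaplacian, neg_neg, one_mul] at this
    simpa only [F, y, add_sub_cancel_right] using this
  have hF : ∀ n, |F n| = |y n| ^ (p - 1) := fun n => by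
    have h := Real.rpow_add_of_nonneg (abs_nonneg (y n)) zero_le_one (by linarith : 0 ≤ p - 2)
    rw [Real.rpow_one, show 1 + (p - 2) = p - 1 by ring] at h
    rw [h, abs_mul, abs_of_nonneg (Real.rpow_nonneg (abs_nonneg _) _)]
  have hbdd : BddAbove (Set.range fun n => |F n|) := by
    refine ⟨(C + C) ^ (p - 1), ?_⟩
    rintro _ ⟨n, rfl⟩
    simp only [hF]
    exact Real.rpow_le_rpow (abs_nonneg _)
      ((abs_sub _ _).trans (add_le_add (hC _) (hC _))) (by linarith)
  set M := ⨆ n, |F n| with hM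
  have hle : ∀ n, |F n| ≤ M := le_ciSup hbdd
  have key : ∀ n, 2 * |F n| + |y n| ≤ 2 * M := by
    intro n
    have hr : 0 ≤ |y n| ^ (p - 2) := Real.rpow_nonneg (abs_nonneg _) _
    have e1 : F (n + 1) + F (n - 1) = y n * (2 * |y n| ^ (p - 2) + 1) := by
      have h1 := haF n
      have h2 := haF (n - 1)
      rw [sub_add_cancel] at h2
      have h3 : y n = a n - a (n - 1) := rfl
      have h4 : F n = y n * |y n| ^ (p - 2) := rfl
      linarith
    have e2 : |F (n + 1) + F (n - 1)| = 2 * |F n| + |y n| := by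
      rw [e1, abs_mul, abs_of_nonneg (by linarith : 0 ≤ 2 * |y n| ^ (p - 2) + 1)]
      simp only [F]
      rw [abs_mul, abs_of_nonneg hr]
      ring
    rw [← e2]
    linarith [abs_add_le (F (n + 1)) (F (n - 1)), hle (n + 1), hle (n - 1)]
  have hM0 : M ≤ 0 := by
    by_contra! hpos
    let δ := (M / 2) ^ (1 / (p - 1))
    have hδ : 0 < δ := Real.rpow_pos_of_pos (by linarith) _
    have hb : ∀ n, |F n| ≤ max (M / 2) (M - δ / 2) := by
      intro n
      rcases le_or_gt |F n| (M / 2) with h | h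
      · exact h.trans (le_max_left _ _)
      · have h1 : δ ≤ |y n| := by
          have := Real.rpow_le_rpow (by linarith) h.le
            (one_div_nonneg.2 (by linarith : 0 ≤ p - 1))
          rwa [hF, ← Real.rpow_mul (abs_nonneg _), mul_one_div_cancel (by linarith),
            Real.rpow_one] at this
        refine le_trans ?_ (le_max_right _ _)
        linarith [key n]
    have h1 : M ≤ max (M / 2) (M - δ / 2) := ciSup_le hb
    rcases le_max_iff.1 h1 with h | h <;> linarith
  have hF0 : ∀ n, F n = 0 := fun n => abs_nonpos_iff.1 ((hle n).trans hM0)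
  rw [haF, hF0, hF0, sub_zero]

/-! ### Solutions from the site-centred and bond-centred profiles -/

theorem theorem1 (p : ℝ) (hp : 2 < p) :
    -- a site-centered and a bond-centered staggered homoclinic solution for s = 1
    (∃ a₁ a₂ : ℤ → ℝ,
      (∀ a ∈ ({a₁, a₂} : Set (ℤ → ℝ)),
        IsStationaryDpS p 1 a ∧ IsHomoclinicToZero a ∧
        (∀ n : ℤ, 0 < (-1 : ℝ) ^ n * a n) ∧
        (∀ n : ℤ, n ≤ 0 → |a (n - 1)| < |a n|)) ∧
      (∀ n : ℤ, a₁ n = a₁ (-n)) ∧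
      (∀ n : ℤ, a₂ n = -a₂ (-n + 1))) ∧
    -- the homoclinic solutions in force variables, with exponent α = p - 1
    (∃ x₁ x₂ : ℤ → ℝ,
      (∀ x ∈ ({x₁, x₂} : Set (ℤ → ℝ)),
        IsForceSolution (p - 1) x ∧ IsHomoclinicToZero x ∧
        (∀ n : ℤ, n ≤ 0 → 0 < x (n - 1) ∧ x (n - 1) < x n) ∧
        (4 : ℝ) ^ ((p - 1) / (1 - (p - 1))) < x 0) ∧
      (∀ n : ℤ, x₁ n = x₁ (-n + 1)) ∧
      (∀ n : ℤ, x₂ n = x₂ (-n))) ∧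
    -- for s = -1 the only bounded solution is zero
    (∀ a : ℤ → ℝ,
      (IsStationaryDpS p (-1) a ∧ ∃ C : ℝ, ∀ n : ℤ, |a n| ≤ C) ↔ ∀ n : ℤ, a n = 0) := by
  obtain ⟨u, hu, hus, hum, hul, hue⟩ := exists_profile hp (Or.inl rfl : (0 : ℤ) = 0 ∨ (0 : ℤ) = 1)
  obtain ⟨v, hv, hvs, hvm, hvl, hve⟩ := exists_profile hp (Or.inr rfl : (1 : ℤ) = 0 ∨ (1 : ℤ) = 1)
  have hbpos : ∀ {w : ℤ → ℝ}, (∀ n, 0 < w n) → ∀ n, 0 < bondSum w n ^ (p - 1) :=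
    fun hw n => Real.rpow_pos_of_pos (add_pos (hw _) (hw _)) _
  have hblt : ∀ {w : ℤ → ℝ}, (∀ n, 0 < w n) → ∀ m n, bondSum w m < bondSum w n →
      bondSum w m ^ (p - 1) < bondSum w n ^ (p - 1) := fun hw m n h =>
    Real.rpow_lt_rpow (bondSum_nonneg (fun n => (hw n).le) m) h (by linarith)
  refine ⟨⟨fun n => (-1 : ℝ) ^ n * u n, fun n => (-1 : ℝ) ^ n * v n, ?_, fun n => ?_, fun n => ?_⟩,
    ⟨fun n => bondSum u (n + -1) ^ (p - 1), fun n => bondSum v (n + 0) ^ (p - 1), ?_, fun n => ?_,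
      fun n => ?_⟩,
    fun a => ⟨fun h => ?_, fun h => ⟨fun n => ?_, 0, fun n => ?_⟩⟩⟩
  · have key : ∀ w : ℤ → ℝ, (∀ n, 0 < w n) → (∀ n ≤ 0, w (n - 1) < w n) →
        IsHomoclinicToZero w → (∀ n, staggeredOp p w n = w n) →
        IsStationaryDpS p 1 (fun n => (-1 : ℝ) ^ n * w n) ∧
        IsHomoclinicToZero (fun n => (-1 : ℝ) ^ n * w n) ∧
        (∀ n : ℤ, 0 < (-1 : ℝ) ^ n * ((-1 : ℝ) ^ n * w n)) ∧
        (∀ n : ℤ, n ≤ 0 → |(-1 : ℝ) ^ (n - 1) * w (n - 1)| < |(-1 : ℝ) ^ n * w n|) := by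
      intro w hw hm hl he
      refine ⟨isStationaryDpS_staggered hp hw he, isHomoclinicToZero_staggered hl,
        fun n => ?_, fun n hn => ?_⟩
      · rw [← mul_assoc, ← mul_zpow]
        simpa using hw n
      · rw [abs_mul, abs_mul, abs_neg_one_zpow, abs_neg_one_zpow, one_mul, one_mul,
          abs_of_pos (hw _), abs_of_pos (hw _)]
        exact hm n hn
    rintro a (rfl | rfl)
    · exact key u hu hum hul hue
    · exact key v hv hvm hvl hve
  · have := hus n
    rw [zero_sub] at this
    simp only [this, zpow_neg, ← inv_zpow, inv_neg_one]
  · have := hvs n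
    rw [show (1 : ℤ) - n = -n + 1 by ring] at this
    simp only [this, zpow_add_one₀ (by norm_num : (-1 : ℝ) ≠ 0), zpow_neg, ← inv_zpow, inv_neg_one]
    ring
  · rintro x (rfl | rfl)
    · have hmono : ∀ n ≤ 0, bondSum u (n - 1 + -1) ^ (p - 1) < bondSum u (n + -1) ^ (p - 1) := by
        intro n hn
        refine hblt hu _ _ ?_
        have h1 := hum n hn
        have h2 := hum (n - 1) (by omega)
        simp only [bondSum, ← sub_eq_add_neg, sub_add_cancel]
        linarith
      refine ⟨isForceSolution_bondSum hp hu hue _, isHomoclinicToZero_bondSum hp hul _,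
        fun n hn => ⟨hbpos hu _, hmono n hn⟩, ?_⟩
      refine (isForceSolution_bondSum hp hu hue (-1)).lt_apply_zero (by linarith) (hbpos hu _)
        (le_of_eq ?_) (hmono 0 le_rfl)
      have := hus 1
      simp only [zero_sub] at this
      simp [bondSum, this, add_comm]
    · have hmono : ∀ n ≤ 0, bondSum v (n - 1 + 0) ^ (p - 1) < bondSum v (n + 0) ^ (p - 1) := by
        intro n hn
        refine hblt hv _ _ ?_
        have h1 := hvm n hn
        have h2 : v n ≤ v (n + 1) := by
          rcases hn.lt_or_eq with h | rfl
          · simpa using (hvm (n + 1) (by omega)).le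
          · simpa using (hvs 1).le
        simp only [bondSum, add_zero, sub_add_cancel]
        linarith
      refine ⟨isForceSolution_bondSum hp hv hve _, isHomoclinicToZero_bondSum hp hvl _,
        fun n hn => ⟨hbpos hv _, hmono n hn⟩, ?_⟩
      refine (isForceSolution_bondSum hp hv hve 0).lt_apply_zero (by linarith) (hbpos hv _)
        ?_ (hmono 0 le_rfl)
      -- the sequence is even, so its values at `1` and `-1` agree
      refine le_trans (le_of_eq ?_) (hmono 0 le_rfl).le
      have h1 := hvs 1
      have h2 := hvs 2
      norm_num at h1 h2
      norm_num [bondSum, h1, h2, add_comm]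
  · have h1 := hus n
    have h2 := hus (n - 1)
    simp only [bondSum]
    rw [show n + -1 + 1 = n by ring, show n + -1 = n - 1 by ring,
      show -n + 1 + -1 + 1 = 0 - (n - 1) by ring, show -n + 1 + -1 = 0 - n by ring, h1, h2, add_comm]
  · have h1 := hvs n
    have h2 := hvs (n + 1)
    simp only [bondSum, add_zero]
    rw [show -n + 1 = 1 - n by ring, show -n = 1 - (n + 1) by ring, h1, h2, add_comm]
  · obtain ⟨ha, C, hC⟩ := h
    exact eq_zero_of_bounded hp ha hC
  · simp [discretePLaplacian, h]
  · simp [h]
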